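/- Let $\mathbb{H}$ be the quaternions with inner product $\langle x,y\rangle=\mathrm{Re}(x\overline{y})$, let $\mathbb{S}^3\subset\mathbb{H}$ be the set of unit quaternions, and let $\mathbb{S}^2\subset\mathbb{S}^3$ be the set of unit imaginary quaternions. Fix $\xi\in\mathbb{S}^2$ and let $\pi_\xi:\mathbb{S}^3\to\mathbb{S}^2$, $\pi_\xi(y)=y\,\xi\,y^{-1}$, be the Hopf projection. A smooth curve $c:\mathbb{R}\to\mathbb{S}^3$ is \emph{left $\xi$-horizontal} if $\langle \dot c(t),c(t)\xi\rangle=0$ for all $t$. For $q\in\mathbb{R}$ it is \emph{$q$-quasiperiodic} if there exists $p\in\mathbb{R}$ such that $c(x+p)=c(x)\,e^{2\pi q\xi}$ for all $x\in\mathbb{R}$. Choose an orientation of $\mathbb{S}^2$, with area form $\mathrm{dArea}_x(u,v)=\sigma\langle x,u\times v\rangle$, where $\sigma=1$ for the orientation by the outward normal and $\sigma=-1$ for the opposite one; the latter is the one for which $d\alpha_\xi=\tfrac12\pi_\xi^*\mathrm{dArea}$, where $\alpha_\xi$ is the $1$-form on $\mathbb{S}^3$ given by $\alpha_\xi(v)=\langle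 y\xi,v\rangle$ for $v\in T_y\mathbb{S}^3$. If $\gamma:\mathbb{R}\to\mathbb{S}^2$ is smooth and has period $p>0$, the \emph{signed area} bounded by $\gamma$ is the class modulo $4\pi$ of $\int_{\overline{B}_1(0)}f^*\mathrm{dArea}$, where $f:\overline{B}_1(0)\to\mathbb{S}^2$ is any piecewise smooth map of the closed unit disc with $f(e^{2\pi i t})=\gamma(pt)$ for all $t\in\mathbb{R}$. \textbf{Theorem (Quasiperiodicity of horizontal lifts).} Let $\gamma:\mathbb{R}\to\mathbb{S}^2$ be a smooth curve of period $p>0$, and let $\hat\gamma:\mathbb{R}\to\mathbb{S}^3$ be a left $\xi$-horizontal curve with $\pi_\xi\circ\hat\gamma=\gamma$. Let $q\in\mathbb{R}$, and suppose that the signed area bounded by $\gamma$ is equal to $-4\pi q$ modulo $4\pi$. Then $\hat\gamma$ is $q$-quasiperiodic. More precisely, for all $x\in\mathbb{R}$, $\hat\gamma(x+p)=\hat\gamma(x)\,e^{2\pi q\xi}$ if $\sigma=-1$, and $\hat\gamma(x-p)=\hat\gamma(x)\,e^{2\pi q\xi}$ if $\sigma=1$. -/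

import Mathlib

open scoped Quaternion ContDiff

noncomputable section

namespace HopfLift

/-- The unit quaternions. Mathlib's inner product on `ℍ[ℝ]` is `⟪x, y⟫ = Re (x * star y)`. -/
def S3 : Set ℍ[ℝ] := {x | ‖x‖ = 1}

/-- The unit imaginary quaternions. -/
def S2 : Set ℍ[ℝ] := {x | x.re = 0 ∧ ‖x‖ = 1}

/-- The Hopf projection `π_ξ(y) = y ξ y⁻¹` from `S3` to `S2`. -/
def hopf (ξ y : ℍ[ℝ]) : ℍ[ℝ] := y * ξ * y⁻¹

/-- A smooth curve in `S3` whose velocity is everywhere orthogonal to the left translate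
`y ↦ y ξ` of `ξ`. -/
def IsLeftHorizontal (ξ : ℍ[ℝ]) (c : ℝ → ℍ[ℝ]) : Prop :=
  ContDiff ℝ ∞ c ∧ (∀ t, c t ∈ S3) ∧ ∀ t, inner ℝ (deriv c t) (c t * ξ) = 0

/-- `c` is a left `ξ`-horizontal lift of `γ` through the Hopf projection `π_ξ`. -/
def IsHorizontalLift (ξ : ℍ[ℝ]) (γ c : ℝ → ℍ[ℝ]) : Prop :=
  IsLeftHorizontal ξ c ∧ ∀ t, hopf ξ (c t) = γ t

/-- `c` is `q`-quasiperiodic: for some real `p`, `c (x + p) = c x * e^{2πqξ}` for all `x`. -/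
def IsQuasiperiodic (ξ : ℍ[ℝ]) (q : ℝ) (c : ℝ → ℍ[ℝ]) : Prop :=
  ∃ p : ℝ, ∀ x, c (x + p) = c x * NormedSpace.exp ((2 * Real.pi * q) • ξ)

/-- The area form of `S2` at `x`, evaluated on tangent vectors `u`, `v`. For imaginary `u`, `v` the
cross product is `u × v = (u * v - v * u) / 2`, so this is `σ ⟪x, u × v⟫`: the orientation by the
outward normal for `σ = 1`, and the opposite orientation for `σ = -1`. -/
def areaForm (σ : ℤˣ) (x u v : ℍ[ℝ]) : ℝ :=
  ((σ : ℤ) : ℝ) * ((1 / 2) * inner ℝ x (u * v - v * u))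

/-- The closed unit disc. -/
def disc : Set ℂ := Metric.closedBall 0 1

/-- Piecewise smoothness on the closed disc: `f` is continuous there, and the disc is covered by
finitely many closed pieces, on each of which `f` is the restriction of a smooth map. (The pieces of
a triangulation are an example; no regularity of the pieces is required. Such an `f` is Lipschitz
on the disc, so that it is differentiable almost everywhere with a bounded derivative.) -/
def PiecewiseSmoothOnDisc (f : ℂ → ℍ[ℝ]) : Prop :=
  ContinuousOn f disc ∧
    ∃ (n : ℕ) (K : Fin n → Set ℂ) (g : Fin n → ℂ → ℍ[ℝ]),
      (∀ i, IsClosed (K i)) ∧ disc ⊆ (⋃ i, K i) ∧ (∀ i, ContDiff ℝ ∞ (g i)) ∧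
        ∀ i, Set.EqOn f (g i) (K i ∩ disc)

/-- `f` restricts to a piecewise smooth map from the closed disc to `S2` that extends the closed
curve `γ` of period `p`, viewed as the map `e^{2πit} ↦ γ (p t)` on the unit circle. -/
def IsDiscExtension (γ : ℝ → ℍ[ℝ]) (p : ℝ) (f : ℂ → ℍ[ℝ]) : Prop :=
  PiecewiseSmoothOnDisc f ∧ Set.MapsTo f disc S2 ∧
    ∀ t : ℝ, f (Complex.exp (2 * Real.pi * t * Complex.I)) = γ (p * t)

/-- The integral over the disc of the pullback by `f` of the area form. -/
def pullbackArea (σ : ℤˣ) (f : ℂ → ℍ[ℝ]) : ℝ :=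
  ∫ z in disc, areaForm σ (f z) (fderiv ℝ f z 1) (fderiv ℝ f z Complex.I)

/-- `A ∈ ℝ / 4πℤ` is the signed area bounded by the closed curve `γ` of period `p`: the integral
modulo `4π` of the pullback of the area form by an extension of `γ` to the disc. -/
def IsSignedArea (σ : ℤˣ) (γ : ℝ → ℍ[ℝ]) (p : ℝ) (A : AddCircle (4 * Real.pi)) : Prop :=
  ∃ f : ℂ → ℍ[ℝ], IsDiscExtension γ p f ∧ ((pullbackArea σ f : ℝ) : AddCircle (4 * Real.pi)) = A

end HopfLift

end

noncomputable section

namespace HopfLift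

open Set Filter Topology MeasureTheory

/-! The form `⟪dy, yξ⟫` is a connection on the Hopf bundle whose curvature is, up to sign, half the
pulled-back area form, so the holonomy around the boundary of a disc is governed by the area of the
disc. To use this, lift the extension `f` to `F` with `F ξ F⁻¹ = f` (`exists_isLip_lift`). Then `f^*
dArea = -2σ jac (F ξ) F` almost everywhere (`areaForm_hopf`), and Stokes gives area `-2σA`, where
`A` is the integral of `⟪G', G ξ⟫` along the boundary values `G` of `F` (`integral_jac_disc`). The
horizontal lift `c` differs from the closed lift `G` by a factor in the circle `exp (ℝ ξ)`, which
rotates at the rate `-⟪G', G ξ⟫` (`horizontal_lift_drift`). One period therefore gives `c (x + p)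
exp (A ξ) = c x`. Since `-2σA ≡ -4πq` modulo `4π`, `σA ≡ 2πq` modulo `2π`, and the two signs of `σ`
yield the two formulas.

The pieces of `f` have no regularity, so everything is done for Lipschitz maps: derivatives exist
almost everywhere, and Stokes reduces to the weak symmetry of mixed derivatives,
`integral_lineDeriv_mul_lineDeriv_comm`. -/

/-- Lipschitz continuity with an unspecified constant. -/
def IsLip {X Y : Type*} [PseudoEMetricSpace X] [PseudoEMetricSpace Y] (f : X → Y) : Prop :=
  ∃ C, LipschitzWith C f

/-! ### Calculus of Lipschitz maps -/

section IsLip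

variable {X : Type*} [PseudoMetricSpace X] {E : Type*} [NormedAddCommGroup E]

theorem IsLip.of_norm_sub_le {f : X → E} (C : ℝ) (h : ∀ x y, ‖f x - f y‖ ≤ C * dist x y) :
    IsLip f := by
  refine ⟨C.toNNReal, LipschitzWith.of_dist_le_mul fun x y => ?_⟩
  rw [dist_eq_norm]
  exact (h x y).trans (by gcongr; exact Real.le_coe_toNNReal C)

theorem IsLip.comp {Y Z : Type*} [PseudoEMetricSpace Y] [PseudoEMetricSpace Z] {W : Type*}
    [PseudoEMetricSpace W] {g : Y → Z} {f : W → Y} (hg : IsLip g) (hf : IsLip f) :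
    IsLip (fun x => g (f x)) := by
  obtain ⟨C, hC⟩ := hg
  obtain ⟨D, hD⟩ := hf
  exact ⟨_, hC.comp hD⟩

theorem IsLip.continuous {f : X → E} (hf : IsLip f) : Continuous f :=
  hf.choose_spec.continuous

theorem isLip_const (c : E) : IsLip (fun _ : X => c) := ⟨0, LipschitzWith.const c⟩

theorem IsLip.sub {f g : X → E} (hf : IsLip f) (hg : IsLip g) : IsLip (fun x => f x - g x) := by
  obtain ⟨C, hC⟩ := hf
  obtain ⟨D, hD⟩ := hg
  exact ⟨_, hC.sub hD⟩

variable [NormedSpace ℝ E]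

theorem _root_.ContinuousLinearMap.isLip {F : Type*} [NormedAddCommGroup F] [NormedSpace ℝ F]
    (L : E →L[ℝ] F) : IsLip (fun x => L x) := ⟨_, L.lipschitz⟩

theorem IsLip.bilin {F G : Type*} [NormedAddCommGroup F] [NormedSpace ℝ F]
    [NormedAddCommGroup G] [NormedSpace ℝ G] (B : E →L[ℝ] F →L[ℝ] G)
    {f : X → E} {g : X → F} (hf : IsLip f) (hg : IsLip g) {Mf Mg : ℝ}
    (hMf : ∀ x, ‖f x‖ ≤ Mf) (hMg : ∀ x, ‖g x‖ ≤ Mg) : IsLip (fun x => B (f x) (g x)) := by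
  obtain ⟨C, hC⟩ := hf
  obtain ⟨D, hD⟩ := hg
  refine .of_norm_sub_le (‖B‖ * (C * Mg + Mf * D)) fun x y => ?_
  have h1 := hC.dist_le_mul x y
  have h2 := hD.dist_le_mul x y
  rw [dist_eq_norm] at h1 h2
  have e : B (f x) (g x) - B (f y) (g y) = B (f x - f y) (g x) + B (f y) (g x - g y) := by
    simp
  have h3 := B.le_opNorm₂ (f x - f y) (g x)
  have h4 := B.le_opNorm₂ (f y) (g x - g y)
  have hM : 0 ≤ Mf := (norm_nonneg _).trans (hMf x)
  rw [e]
  calc _ ≤ ‖B‖ * ‖f x - f y‖ * ‖g x‖ + ‖B‖ * ‖f y‖ * ‖g x - g y‖ :=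
        (norm_add_le _ _).trans (add_le_add h3 h4)
    _ ≤ ‖B‖ * (C * dist x y) * Mg + ‖B‖ * Mf * (D * dist x y) := by
        gcongr
        exacts [hMg x, hMf y]
    _ = _ := by ring

theorem IsLip.mul {A : Type*} [NormedRing A] [NormedAlgebra ℝ A] {f g : X → A} (hf : IsLip f)
    (hg : IsLip g) {Mf Mg : ℝ} (hMf : ∀ x, ‖f x‖ ≤ Mf) (hMg : ∀ x, ‖g x‖ ≤ Mg) :
    IsLip (fun x => f x * g x) :=
  hf.bilin (ContinuousLinearMap.mul ℝ A) hg hMf hMg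

theorem IsLip.smul {f : X → ℝ} {g : X → E} (hf : IsLip f)
    (hg : IsLip g) {Mf Mg : ℝ} (hMf : ∀ x, ‖f x‖ ≤ Mf) (hMg : ∀ x, ‖g x‖ ≤ Mg) :
    IsLip (fun x => f x • g x) :=
  hf.bilin (ContinuousLinearMap.lsmul ℝ ℝ) hg hMf hMg

/-- The radial retraction onto the closed unit ball. -/
def retr (w : E) : E := (max 1 ‖w‖)⁻¹ • w

theorem norm_retr_le (w : E) : ‖retr w‖ ≤ 1 := by
  have h : 0 < max 1 ‖w‖ := by positivity
  rw [retr, norm_smul, norm_inv, Real.norm_of_nonneg h.le, inv_mul_le_one₀ h]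
  exact le_max_right _ _

theorem retr_of_norm_le {w : E} (h : ‖w‖ ≤ 1) : retr w = w := by
  simp [retr, max_eq_left h]

theorem retr_of_le_norm {w : E} (h : 1 ≤ ‖w‖) : retr w = ‖w‖⁻¹ • w := by
  simp [retr, max_eq_right h]

theorem isLip_retr : IsLip (retr : E → E) := by
  refine .of_norm_sub_le 2 fun w v => ?_
  have hw : 0 < max 1 ‖w‖ := by positivity
  have hv : 0 < max 1 ‖v‖ := by positivity
  have e : retr w - retr v =
      (max 1 ‖w‖)⁻¹ • (w - v) + ((max 1 ‖w‖)⁻¹ - (max 1 ‖v‖)⁻¹) • v := by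
    simp only [retr, smul_sub, sub_smul]; abel
  have h1 : ‖(max 1 ‖w‖)⁻¹ • (w - v)‖ ≤ ‖w - v‖ := by
    rw [norm_smul, norm_inv, Real.norm_of_nonneg hw.le]
    exact mul_le_of_le_one_left (norm_nonneg _) (inv_le_one_of_one_le₀ (le_max_left _ _))
  have h2 : ‖((max 1 ‖w‖)⁻¹ - (max 1 ‖v‖)⁻¹) • v‖ ≤ ‖w - v‖ := by
    rw [norm_smul, inv_sub_inv hw.ne' hv.ne', norm_div, Real.norm_eq_abs, norm_mul,
      Real.norm_of_nonneg hw.le, Real.norm_of_nonneg hv.le, div_mul_eq_mul_div,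
      div_le_iff₀ (by positivity)]
    have h3 : |max 1 ‖v‖ - max 1 ‖w‖| ≤ ‖w - v‖ := by
      refine (abs_max_sub_max_le_max _ _ _ _).trans ?_
      rw [sub_self, abs_zero, max_eq_right (abs_nonneg _), norm_sub_rev w v]
      exact abs_norm_sub_norm_le _ _
    have h4 : ‖v‖ ≤ max 1 ‖w‖ * max 1 ‖v‖ :=
      (le_max_right _ _).trans (le_mul_of_one_le_left hv.le (le_max_left _ _))
    exact mul_le_mul h3 h4 (norm_nonneg _) (norm_nonneg _)
  rw [e, dist_eq_norm]
  linarith [norm_add_le ((max 1 ‖w‖)⁻¹ • (w - v)) (((max 1 ‖w‖)⁻¹ - (max 1 ‖v‖)⁻¹) • v)]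

end IsLip

/-! ### Piecewise smooth maps of the disc are Lipschitz -/

section Piecewise

variable {E : Type*} [NormedAddCommGroup E]

/-- A continuous curve that agrees on each of finitely many closed pieces with an `L`-Lipschitz
curve is `L`-Lipschitz. -/
theorem norm_sub_le_of_closed_cover {ι : Type*} [Finite ι] {a b L : ℝ} {h : ℝ → E}
    (hc : ContinuousOn h (Icc a b)) (C : ι → Set ℝ) (hC : ∀ i, IsClosed (C i))
    (hcov : Icc a b ⊆ ⋃ i, C i)
    (hL : ∀ i, ∀ s ∈ C i ∩ Icc a b, ∀ t ∈ C i ∩ Icc a b, ‖h t - h s‖ ≤ L * |t - s|)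
    {x : ℝ} (hx : x ∈ Icc a b) : ‖h x - h a‖ ≤ L * (x - a) := by
  refine image_le_of_liminf_slope_right_le_deriv_boundary (f := fun t => ‖h t - h a‖)
    (B := fun t => L * (t - a)) (B' := fun _ => L) (hc.sub continuousOn_const).norm
    (by simp) (by fun_prop)
    (fun t _ => by simpa using (((hasDerivAt_id t).sub_const a).const_mul L).hasDerivWithinAt)
    (fun t ht r hr => ?_) hx
  have hmem : ∀ᶠ z in 𝓝[>] t, z ∈ Icc a b := by
    filter_upwards [Ioo_mem_nhdsGT ht.2] with z hz
    exact ⟨ht.1.trans hz.1.le, hz.2.le⟩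
  -- There are finitely many pieces, so one of them contains points arbitrarily close to `t` on the
  -- right. Being closed it contains `t`, so its bound controls the right slope at `t` along these
  -- points.
  have hex : ∃ i, ∃ᶠ z in 𝓝[>] t, z ∈ C i := by
    by_contra! hcon
    have h2 : ∀ᶠ z in 𝓝[>] t, ∀ i, z ∉ C i := eventually_all.2 hcon
    obtain ⟨z, hz1, hz2⟩ := (h2.and hmem).exists
    obtain ⟨i, hi⟩ := mem_iUnion.1 (hcov hz2)
    exact hz1 i hi
  obtain ⟨i, hi⟩ := hex
  have hti : t ∈ C i := by
    have := (hi.filter_mono nhdsWithin_le_nhds).mem_closure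
    rwa [(hC i).closure_eq] at this
  refine ((hi.and_eventually hmem).and_eventually self_mem_nhdsWithin).mono ?_
  rintro z ⟨⟨hz1, hz2⟩, hz3⟩
  have hz4 : 0 < z - t := sub_pos.2 hz3
  have := hL i t ⟨hti, Ico_subset_Icc_self ht⟩ z ⟨hz1, hz2⟩
  rw [abs_of_pos hz4] at this
  rw [slope_def_field]
  refine lt_of_le_of_lt ?_ hr
  rw [div_le_iff₀ hz4]
  have h3 := norm_sub_norm_le (h z - h a) (h t - h a)
  rw [sub_sub_sub_cancel_right] at h3
  linarith

/-- The disc is convex, so the one-dimensional bound applies along the segment joining two points,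
with the largest of the Lipschitz constants of the pieces. -/
theorem PiecewiseSmoothOnDisc.exists_lipschitzOnWith {f : ℂ → ℍ[ℝ]}
    (hf : PiecewiseSmoothOnDisc f) : ∃ L, LipschitzOnWith L f disc := by
  obtain ⟨hc, n, K, g, hK, hcov, hg, heq⟩ := hf
  have hdisc : Convex ℝ disc := convex_closedBall 0 1
  have h1 : ∀ i, ∃ L, LipschitzOnWith L (g i) disc := fun i =>
    ((hg i).of_le (by simp)).contDiffOn.exists_lipschitzOnWith (n := 1) (by simp) hdisc
      (isCompact_closedBall _ _)
  choose L hL using h1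
  refine ⟨Finset.univ.sup L, LipschitzOnWith.of_dist_le_mul fun x hx y hy => ?_⟩
  have hseg : ∀ t ∈ Icc (0 : ℝ) 1, AffineMap.lineMap y x t ∈ disc := fun t ht =>
    hdisc.segment_subset hy hx (lineMap_mem_segment ℝ y x ht)
  have := norm_sub_le_of_closed_cover (a := 0) (b := 1) (x := 1)
    (L := (Finset.univ.sup L : NNReal) * dist x y)
    (h := fun t => f (AffineMap.lineMap y x t))
    (hc.comp (by fun_prop) hseg)
    (fun i => AffineMap.lineMap y x ⁻¹' K i) (fun i => (hK i).preimage (by fun_prop))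
    (fun t ht => by simpa using hcov (hseg t ht)) ?_ (by simp)
  · simpa [dist_eq_norm] using this
  · rintro i s ⟨hs1, hs2⟩ t ⟨ht1, ht2⟩
    have h2 := (hL i).dist_le_mul _ (hseg t ht2) _ (hseg s hs2)
    rw [← dist_eq_norm, heq i ⟨hs1, hseg s hs2⟩, heq i ⟨ht1, hseg t ht2⟩]
    refine h2.trans ?_
    rw [dist_lineMap_lineMap, Real.dist_eq, dist_comm y x, mul_comm |t - s|, ← mul_assoc]
    gcongr
    exact_mod_cast Finset.le_sup (f := L) (Finset.mem_univ i)

end Piecewise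

/-! ### Lifting a disc through the Hopf projection -/

theorem S2.mul_self {x : ℍ[ℝ]} (hx : x ∈ S2) : x * x = -1 := by
  have h1 : star x = -x := by
    rw [Quaternion.star_eq_two_re_sub, hx.1]; simp
  have h2 : x * star x = 1 := by
    rw [Quaternion.self_mul_star, Quaternion.normSq_eq_norm_mul_self, hx.2]; simp
  rw [h1] at h2
  rw [← neg_eq_iff_eq_neg, ← h2, mul_neg]

/-- If two Lipschitz maps to `S2` are pointwise close, some Lipschitz family of unit quaternions
conjugates one to the other. -/
theorem exists_isLip_conj {x y : ℂ → ℍ[ℝ]} (hx : IsLip x) (hy : IsLip y) (hxS : ∀ z, x z ∈ S2)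
    (hyS : ∀ z, y z ∈ S2) (hxy : ∀ z, ‖x z - y z‖ ≤ 1) :
    ∃ s : ℂ → ℍ[ℝ], IsLip s ∧ (∀ z, ‖s z‖ = 1) ∧ ∀ z, s z * y z = x z * s z := by
  -- The conjugator is `1 - x y`, normalised: as `x² = y² = -1`, both `(1 - x y) y` and `x (1 - x
  -- y)` equal `x + y`. Its norm is that of `x + y = 2x - (x - y)`, hence at least `1`, and there
  -- `retr` is normalisation.
  have hn : ∀ z, 1 ≤ ‖1 - x z * y z‖ := fun z => by
    have e : x z * (1 - x z * y z) = (2 : ℝ) • x z - (x z - y z) := by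
      rw [mul_sub, ← mul_assoc, S2.mul_self (hxS z), two_smul]; noncomm_ring
    have h1 : ‖x z * (1 - x z * y z)‖ = ‖1 - x z * y z‖ := by rw [norm_mul, (hxS z).2, one_mul]
    have h2 := norm_sub_norm_le ((2 : ℝ) • x z) (x z - y z)
    rw [← e, h1, norm_smul, (hxS z).2] at h2
    have := hxy z
    norm_num at h2
    linarith
  refine ⟨fun z => retr (1 - x z * y z), isLip_retr.comp ((isLip_const 1).sub
    (hx.mul hy (fun z => (hxS z).2.le) (fun z => (hyS z).2.le))), fun z => ?_, fun z => ?_⟩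
  · have := hn z
    beta_reduce
    rw [retr_of_le_norm this, norm_smul, norm_inv, norm_norm, inv_mul_cancel₀]
    positivity
  · simp only [retr_of_le_norm (hn z), smul_mul_assoc, mul_smul_comm, sub_mul, mul_sub, one_mul,
      mul_one]
    rw [mul_assoc, S2.mul_self (hyS z), ← mul_assoc, S2.mul_self (hxS z)]
    congr 1
    noncomm_ring

/-- A Lipschitz map from the disc to `S2`, retracted to the plane, lifts to a Lipschitz map
to `S3`. -/
theorem exists_isLip_lift {ξ : ℍ[ℝ]} {f : ℂ → ℍ[ℝ]} {L : NNReal} (hf : LipschitzOnWith L f disc)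
    (hfS : MapsTo f disc S2) {y₀ : ℍ[ℝ]} (hy₀ : ‖y₀‖ = 1) (h₀ : y₀ * ξ = f 1 * y₀) :
    ∃ F : ℂ → ℍ[ℝ], IsLip F ∧ (∀ z, ‖F z‖ = 1) ∧ (∀ z, F z * ξ = f (retr z) * F z) ∧
      ∀ z, F (retr z) = F z := by
  -- The disc is contracted to the point `1` in `N` stages. Points of the disc are at distance at
  -- most `2` from `1`, so successive stages of `f` differ by at most `2L / N ≤ 1`, as
  -- `exists_isLip_conj` requires.
  obtain ⟨N, hN⟩ := exists_nat_gt (2 * L : ℝ)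
  have hN0 : (0 : ℝ) < N := lt_of_le_of_lt (by positivity) hN
  have hr : ∀ z : ℂ, retr z ∈ disc := fun z => by simpa [disc] using norm_retr_le z
  have h1 : (1 : ℂ) ∈ disc := by simp [disc]
  have hmem : ∀ z, ∀ t ∈ Icc (0 : ℝ) 1, AffineMap.lineMap 1 (retr z) t ∈ disc := fun z t ht =>
    (convex_closedBall (0 : ℂ) 1).segment_subset h1 (hr z) (lineMap_mem_segment ℝ _ _ ht)
  have hlip : ∀ t ∈ Icc (0 : ℝ) 1, IsLip fun z => f (AffineMap.lineMap 1 (retr z) t) := by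
    intro t ht
    obtain ⟨D, hD⟩ := isLip_retr (E := ℂ)
    refine ⟨L * (‖t‖₊ * D), ?_⟩
    rw [← lipschitzOnWith_univ]
    refine hf.comp (lipschitzOnWith_univ.2 (LipschitzWith.of_dist_le_mul fun z w => ?_))
      fun z _ => hmem z t ht
    have := hD.dist_le_mul z w
    simp only [AffineMap.lineMap_apply, vsub_eq_sub, vadd_eq_add, dist_add_right, smul_sub,
      dist_sub_right]
    rw [dist_smul₀, NNReal.coe_mul, mul_assoc, coe_nnnorm]
    gcongr
  have key : ∀ k : ℕ, k ≤ N → ∃ F : ℂ → ℍ[ℝ], IsLip F ∧ (∀ z, ‖F z‖ = 1) ∧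
      ∀ z, F z * ξ = f (AffineMap.lineMap 1 (retr z) (k / N : ℝ)) * F z := by
    intro k
    induction k with
    | zero => exact fun _ => ⟨fun _ => y₀, isLip_const _, fun _ => hy₀, by simpa using h₀⟩
    | succ k ih =>
      intro hk
      obtain ⟨F, hF, hF1, hFξ⟩ := ih (by omega)
      have hk' : (k : ℝ) + 1 ≤ N := by exact_mod_cast hk
      have hm1 : (k / N : ℝ) ∈ Icc (0 : ℝ) 1 :=
        ⟨by positivity, by rw [div_le_one hN0]; linarith⟩
      have hm2 : ((k + 1 : ℕ) / N : ℝ) ∈ Icc (0 : ℝ) 1 :=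
        ⟨by positivity, by rw [div_le_one hN0]; push_cast; linarith⟩
      obtain ⟨s, hs, hs1, hsc⟩ := exists_isLip_conj (hlip _ hm2) (hlip _ hm1)
        (fun z => hfS (hmem z _ hm2)) (fun z => hfS (hmem z _ hm1)) (fun z => by
          have := hf.dist_le_mul _ (hmem z _ hm2) _ (hmem z _ hm1)
          rw [dist_lineMap_lineMap, dist_eq_norm, Real.dist_eq] at this
          refine this.trans ?_
          have e : ((k + 1 : ℕ) / N : ℝ) - k / N = 1 / N := by push_cast; ring
          have h2 : dist 1 (retr z) ≤ 2 := by
            rw [dist_eq_norm]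
            refine (norm_sub_le _ _).trans ?_
            rw [norm_one]
            linarith [norm_retr_le z]
          rw [e, abs_of_pos (by positivity)]
          calc (L : ℝ) * (1 / N * dist 1 (retr z)) ≤ L * (1 / N * 2) := by gcongr
            _ = 2 * L / N := by ring
            _ ≤ 1 := by rw [div_le_one hN0]; exact hN.le)
      refine ⟨fun z => s z * F z, hs.mul hF (fun z => (hs1 z).le) (fun z => (hF1 z).le),
        fun z => by rw [norm_mul, hs1, hF1, one_mul], fun z => ?_⟩
      rw [mul_assoc, hFξ, ← mul_assoc, hsc, mul_assoc]
  obtain ⟨F, hF, hF1, hFξ⟩ := key N le_rfl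
  have hrr : ∀ z : ℂ, retr (retr z) = retr z := fun z => retr_of_norm_le (norm_retr_le z)
  refine ⟨fun z => F (retr z), hF.comp isLip_retr, fun z => hF1 _, fun z => ?_, fun z => by
    simp only [hrr]⟩
  rw [hFξ, hrr, div_self hN0.ne', AffineMap.lineMap_apply_one]

/-! ### Weak symmetry of mixed derivatives -/

section LineDeriv

variable {E : Type*} [NormedAddCommGroup E] [NormedSpace ℝ E]

theorem lineDeriv_eq_zero_of_notMem_tsupport {u : E → ℝ} {x : E} (hx : x ∉ tsupport u) (v : E) :
    lineDeriv ℝ u x v = 0 := by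
  have h := (notMem_tsupport_iff_eventuallyEq.1 hx).lineDeriv_eq (𝕜 := ℝ) (v := v)
  rw [h]
  simp [lineDeriv]

variable [FiniteDimensional ℝ E] [MeasurableSpace E] [BorelSpace E]
  {μ : Measure E} [μ.IsAddHaarMeasure]

theorem integrable_lineDeriv_of_hasCompactSupport {C : NNReal} {u : E → ℝ}
    (hu : LipschitzWith C u) (hcs : HasCompactSupport u) (v : E) :
    Integrable (fun x => lineDeriv ℝ u x v) μ := by
  rw [← integrableOn_iff_integrable_of_support_subset (s := tsupport u)]
  · exact (hu.locallyIntegrable_lineDeriv v).integrableOn_isCompact hcs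
  · intro x hx
    contrapose! hx
    simpa using lineDeriv_eq_zero_of_notMem_tsupport hx v

/-- Mixed line derivatives of Lipschitz functions may be exchanged under the integral. -/
theorem integral_lineDeriv_mul_lineDeriv_comm {C D : NNReal} {u b : E → ℝ}
    (hu : LipschitzWith C u) (hcs : HasCompactSupport u) (hb : LipschitzWith D b) (v w : E) :
    ∫ x, lineDeriv ℝ u x v * lineDeriv ℝ b x w ∂μ =
      ∫ x, lineDeriv ℝ u x w * lineDeriv ℝ b x v ∂μ := by
  -- Outside `K` the difference quotients of `u` in direction `v` vanish for every step `t ∈ (0,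
  -- 1]`. Truncating `∂_w b` to `K` thus changes no integral and makes it integrable.
  set K := Metric.cthickening ‖v‖ (tsupport u) with hK
  have hKc : IsCompact K := IsCompact.cthickening hcs
  have hsub : tsupport u ⊆ K := Metric.self_subset_cthickening _
  have hcont := hb.continuous
  have hbm : AEStronglyMeasurable (fun x => lineDeriv ℝ b x w) μ :=
    aestronglyMeasurable_lineDeriv hb.continuous μ
  have hbb : ∀ᵐ x ∂μ, ‖lineDeriv ℝ b x w‖ ≤ D * ‖w‖ :=
    .of_forall fun _ => norm_lineDeriv_le_of_lipschitz ℝ hb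
  set h := K.indicator fun x => lineDeriv ℝ b x w with hh
  have hint : Integrable h μ := by
    rw [integrable_indicator_iff hKc.measurableSet]
    exact (hb.locallyIntegrable_lineDeriv w).integrableOn_isCompact hKc
  have hA := hu.integral_inv_smul_sub_mul_tendsto_integral_lineDeriv_mul hint v
  have hB := hb.integral_inv_smul_sub_mul_tendsto_integral_lineDeriv_mul
    (integrable_lineDeriv_of_hasCompactSupport (μ := μ) hu hcs (-w)) (-v)
  have e1 : ∫ x, lineDeriv ℝ u x v * h x ∂μ = ∫ x, lineDeriv ℝ u x v * lineDeriv ℝ b x w ∂μ := by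
    congr 1 with x
    by_cases hx : x ∈ K
    · rw [hh, indicator_of_mem hx]
    · rw [lineDeriv_eq_zero_of_notMem_tsupport (fun h => hx (hsub h)), zero_mul, zero_mul]
  have e2 : ∫ x, lineDeriv ℝ b x (-v) * lineDeriv ℝ u x (-w) ∂μ =
      ∫ x, lineDeriv ℝ u x w * lineDeriv ℝ b x v ∂μ := by
    congr 1 with x
    rw [lineDeriv_neg, lineDeriv_neg]
    ring
  rw [e1] at hA
  rw [e2] at hB
  -- Before the limit the two sides agree: integration by parts moves `w` from `b` to `u`, and
  -- translation invariance moves the shift by `t • v` from `u` to `b`.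
  refine tendsto_nhds_unique (hA.congr' ?_) hB
  filter_upwards [Ioc_mem_nhdsGT zero_lt_one] with t ht
  have hlip : ∀ a : E, LipschitzWith C fun x => u (x + a) := fun a => by
    simpa [Function.comp_def] using hu.comp (LipschitzWith.of_edist_le (f := fun x => x + a) (by simp))
  have hsupp : ∀ a : E, HasCompactSupport fun x => u (x + a) := fun a =>
    hcs.comp_homeomorph (Homeomorph.addRight a)
  have hpart : ∀ a : E, ∫ x, u (x + a) * lineDeriv ℝ b x w ∂μ =
      ∫ x, b (x - a) * lineDeriv ℝ u x (-w) ∂μ := fun a => by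
    have h1 := hb.integral_lineDeriv_mul_eq (μ := μ) (hlip a) (hsupp a) w
    simp_rw [mul_comm (u _)]
    rw [h1, ← integral_add_right_eq_self (μ := μ) (fun x => b (x - a) * lineDeriv ℝ u x (-w)) a]
    congr 1 with x
    rw [add_sub_cancel_right, mul_comm]
    congr 1
    simp only [lineDeriv]
    congr 1 with s
    congr 1
    abel
  have hi1 : ∀ a : E, Integrable (fun x => u (x + a) * lineDeriv ℝ b x w) μ := fun a =>
    (((hlip a).continuous.integrable_of_hasCompactSupport (hsupp a))).mul_bdd hbm hbb
  have hi2 : ∀ a : E, Integrable (fun x => b (x - a) * lineDeriv ℝ u x (-w)) μ := fun a => by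
    rw [← integrableOn_iff_integrable_of_support_subset (s := tsupport u)]
    · exact ((integrable_lineDeriv_of_hasCompactSupport hu hcs (-w)).integrableOn).continuousOn_mul
        (by fun_prop) hcs
    · intro x hx
      contrapose! hx
      simp [lineDeriv_eq_zero_of_notMem_tsupport hx]
  have e3 : ∫ x, (t⁻¹ • (u (x + t • v) - u x)) * h x ∂μ =
      ∫ x, t⁻¹ * (u (x + t • v) * lineDeriv ℝ b x w - u (x + 0) * lineDeriv ℝ b x w) ∂μ := by
    congr 1 with x
    by_cases hx : x ∈ K
    · rw [hh, indicator_of_mem hx, add_zero, smul_eq_mul]; ring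
    · have h1 : u x = 0 := image_eq_zero_of_notMem_tsupport fun h => hx (hsub h)
      have h2 : u (x + t • v) = 0 := by
        refine image_eq_zero_of_notMem_tsupport fun h => hx ?_
        refine Metric.mem_cthickening_of_dist_le _ _ _ _ h ?_
        rw [dist_eq_norm, sub_add_cancel_left, norm_neg, norm_smul, Real.norm_of_nonneg ht.1.le]
        exact mul_le_of_le_one_left (norm_nonneg v) ht.2
      simp [h1, h2]
  have e4 : ∫ x, (t⁻¹ • (b (x + t • -v) - b x)) * lineDeriv ℝ u x (-w) ∂μ =
      ∫ x, t⁻¹ * (b (x - t • v) * lineDeriv ℝ u x (-w) - b (x - 0) * lineDeriv ℝ u x (-w)) ∂μ := by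
    congr 1 with x
    rw [smul_neg, ← sub_eq_add_neg, sub_zero, smul_eq_mul]; ring
  rw [e3, e4, integral_const_mul, integral_const_mul, integral_sub (hi1 _) (hi1 _),
    integral_sub (hi2 _) (hi2 _), hpart, hpart]

end LineDeriv

/-! ### Stokes' theorem on the disc for Lipschitz maps -/

theorem isLip_component {F : ℂ → ℍ[ℝ]} (hF : IsLip F) (L : ℍ[ℝ] →L[ℝ] ℝ) :
    IsLip fun z => L (F z) := L.isLip.comp hF

/-- The Jacobian pairing `⟪∂₁U, ∂₂B⟫ - ⟪∂₂U, ∂₁B⟫` of two maps from the plane. -/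
def jac (U B : ℂ → ℍ[ℝ]) (z : ℂ) : ℝ :=
  inner ℝ (fderiv ℝ U z 1) (fderiv ℝ B z Complex.I) -
    inner ℝ (fderiv ℝ U z Complex.I) (fderiv ℝ B z 1)

theorem exists_clm_components : ∃ L : Fin 4 → ℍ[ℝ] →L[ℝ] ℝ,
    ∀ x y : ℍ[ℝ], inner ℝ x y = ∑ i, L i x * L i y := by
  let b : OrthonormalBasis (Fin 4) ℝ ℍ[ℝ] :=
    (stdOrthonormalBasis ℝ ℍ[ℝ]).reindex (finCongr Quaternion.finrank_eq_four)
  refine ⟨fun i => innerSL ℝ (b i), fun x y => ?_⟩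
  rw [← b.sum_inner_mul_inner]
  simp [real_inner_comm]

/-- In orthonormal coordinates the pairing is a sum of terms `du ∧ db = d(u db)` with `u` compactly
supported, and each integrates to zero by the exchange of mixed derivatives. -/
theorem integrable_jac {U B : ℂ → ℍ[ℝ]} (hU : IsLip U) (hcs : HasCompactSupport U)
    (hB : IsLip B) : Integrable (jac U B) ∧ ∫ z, jac U B z = 0 := by
  obtain ⟨L, hL⟩ := exists_clm_components
  have hae : jac U B =ᵐ[volume] fun z => ∑ i,
      (lineDeriv ℝ (fun z => L i (U z)) z 1 * lineDeriv ℝ (fun z => L i (B z)) z Complex.I -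
        lineDeriv ℝ (fun z => L i (U z)) z Complex.I * lineDeriv ℝ (fun z => L i (B z)) z 1) := by
    filter_upwards [hU.choose_spec.ae_differentiableAt, hB.choose_spec.ae_differentiableAt]
      with z h1 h2
    have h3 : ∀ i, ∀ v, lineDeriv ℝ (fun z => L i (U z)) z v = L i (fderiv ℝ U z v) :=
      fun i v => (((L i).hasFDerivAt.comp z h1.hasFDerivAt).hasLineDerivAt v).lineDeriv
    have h4 : ∀ i, ∀ v, lineDeriv ℝ (fun z => L i (B z)) z v = L i (fderiv ℝ B z v) :=
      fun i v => (((L i).hasFDerivAt.comp z h2.hasFDerivAt).hasLineDerivAt v).lineDeriv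
    simp only [jac, hL, h3, h4, Finset.sum_sub_distrib]
  have hc : ∀ i, HasCompactSupport fun z => L i (U z) := fun i =>
    hcs.comp_left (g := L i) (map_zero _)
  have hi : ∀ i, ∀ v w, Integrable fun z : ℂ =>
      lineDeriv ℝ (fun z => L i (U z)) z v * lineDeriv ℝ (fun z => L i (B z)) z w := by
    intro i v w
    obtain ⟨C, hC⟩ := isLip_component hU (L i)
    obtain ⟨D, hD⟩ := isLip_component hB (L i)
    exact (integrable_lineDeriv_of_hasCompactSupport hC (hc i) v).mul_bdd
      (aestronglyMeasurable_lineDeriv hD.continuous _)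
      (.of_forall fun _ => norm_lineDeriv_le_of_lipschitz ℝ hD)
  refine ⟨(integrable_finsetSum _ fun i _ => (hi i _ _).sub (hi i _ _)).congr hae.symm, ?_⟩
  rw [integral_congr_ae hae, integral_finsetSum _ fun i _ => by exact (hi i _ _).sub (hi i _ _)]
  refine Finset.sum_eq_zero fun i _ => ?_
  obtain ⟨C, hC⟩ := isLip_component hU (L i)
  obtain ⟨D, hD⟩ := isLip_component hB (L i)
  rw [integral_sub (hi i _ _) (hi i _ _),
    integral_lineDeriv_mul_lineDeriv_comm hC (hc i) hD 1 Complex.I, sub_self]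

theorem inner_eq_components (a b : ℍ[ℝ]) :
    inner ℝ a b = a.re * b.re + a.imI * b.imI + a.imJ * b.imJ + a.imK * b.imK := by
  rw [Quaternion.inner_def]; simp

theorem inner_mul_im_self {ξ : ℍ[ℝ]} (hξ : ξ.re = 0) (a : ℍ[ℝ]) : inner ℝ (a * ξ) a = 0 := by
  rw [inner_eq_components]; simp [hξ]; ring

/-- The radial cut-off that is `1` on the unit disc and `0` outside the disc of radius `2`. -/
def cutoff (z : ℂ) : ℝ := max 0 (min 1 (2 - ‖z‖))

theorem isLip_cutoff : IsLip cutoff := by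
  refine .of_norm_sub_le 1 fun x y => ?_
  rw [one_mul, dist_eq_norm, Real.norm_eq_abs]
  refine (abs_max_sub_max_le_max _ _ _ _).trans (max_le (by simp) ?_)
  refine (abs_min_sub_min_le_max _ _ _ _).trans (max_le (by simp) ?_)
  rw [sub_sub_sub_cancel_left, norm_sub_rev]
  exact abs_norm_sub_norm_le _ _

theorem norm_cutoff_le (z : ℂ) : ‖cutoff z‖ ≤ 1 := by
  rw [cutoff, Real.norm_of_nonneg (le_max_left _ _)]
  exact max_le zero_le_one (min_le_left _ _)

theorem cutoff_eq_one {z : ℂ} (h : ‖z‖ ≤ 1) : cutoff z = 1 := by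
  rw [cutoff, min_eq_left (by linarith), max_eq_right zero_le_one]

theorem cutoff_eq_zero {z : ℂ} (h : 2 ≤ ‖z‖) : cutoff z = 0 := by
  rw [cutoff, min_eq_right (by linarith), max_eq_left (by linarith)]

theorem cutoff_eq_sub {z : ℂ} (h1 : 1 ≤ ‖z‖) (h2 : ‖z‖ ≤ 2) : cutoff z = 2 - ‖z‖ := by
  rw [cutoff, min_eq_right (by linarith), max_eq_right (by linarith)]

theorem jac_congr_left {U V B : ℂ → ℍ[ℝ]} {z : ℂ} (h : U =ᶠ[𝓝 z] V) : jac U B z = jac V B z := by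
  rw [jac, jac, h.fderiv_eq]

/-- A map that is constant along rays outside the disc has, in the annulus `1 < |z| < 2`, the
density of its boundary integral as Jacobian pairing with the cut-off map. -/
theorem jac_cutoff_annulus {F : ℂ → ℍ[ℝ]} (hr : ∀ z, F (retr z) = F z) {ξ : ℍ[ℝ]}
    (hξ : ξ.re = 0) {z : ℂ} (hz : z ∈ Complex.slitPlane) (h1 : 1 < ‖z‖) (h2 : ‖z‖ < 2)
    {G' : ℍ[ℝ]}
    (hG : HasDerivAt (fun θ : ℝ => F (Complex.exp (θ * Complex.I))) G' z.arg) :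
    ‖z‖ * jac (fun w => cutoff w • (F w * ξ)) F z = - inner ℝ G' (F z * ξ) := by
  have hz0 : z ≠ 0 := Complex.slitPlane_ne_zero hz
  set lz : ℂ →L[ℝ] ℂ := (ContinuousLinearMap.toSpanSingleton ℂ z⁻¹).restrictScalars ℝ with hlz
  have hlog : HasFDerivAt Complex.log lz z :=
    (Complex.hasStrictDerivAt_log hz).hasDerivAt.hasFDerivAt.restrictScalars ℝ
  have hn : ∀ᶠ w in 𝓝 z, 1 < ‖w‖ := continuous_norm.continuousAt.eventually_const_lt h1
  have hn2 : ∀ᶠ w in 𝓝 z, ‖w‖ < 2 := continuous_norm.continuousAt.eventually_lt_const h2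
  -- The logarithm supplies polar coordinates: `F` depends only on `Im log`, and the cut-off is `2 -
  -- exp (Re log)`.
  have hFd : HasFDerivAt F ((Complex.imCLM.comp lz).smulRight G') z := by
    have h3 : HasFDerivAt (fun w => (Complex.log w).im) (Complex.imCLM.comp lz) z :=
      Complex.imCLM.hasFDerivAt.comp z hlog
    rw [← Complex.log_im] at hG
    have h4 := hG.hasFDerivAt.comp z h3
    have e : (ContinuousLinearMap.toSpanSingleton ℝ G').comp (Complex.imCLM.comp lz) =
        (Complex.imCLM.comp lz).smulRight G' := by ext <;> simp
    rw [e] at h4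
    refine h4.congr_of_eventuallyEq ?_
    filter_upwards [hn] with w hw
    have hw0 : (‖w‖ : ℂ) ≠ 0 := by exact_mod_cast (zero_lt_one.trans hw).ne'
    rw [Function.comp, ← hr w, retr_of_le_norm hw.le, Complex.log_im]
    congr 1
    rw [Complex.real_smul, Complex.ofReal_inv, inv_mul_eq_iff_eq_mul₀ hw0,
      Complex.norm_mul_exp_arg_mul_I]
  have hφd : HasFDerivAt cutoff (-(Real.exp (Complex.log z).re • Complex.reCLM.comp lz)) z := by
    have h3 : HasFDerivAt (fun w => (Complex.log w).re) (Complex.reCLM.comp lz) z :=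
      Complex.reCLM.hasFDerivAt.comp z hlog
    refine (h3.exp.const_sub 2).congr_of_eventuallyEq ?_
    filter_upwards [hn, hn2] with w hw hw2
    rw [cutoff_eq_sub hw.le hw2.le, Complex.log_re, Real.exp_log (zero_lt_one.trans hw)]
  have hU := HasFDerivAt.fderiv (f := fun w => cutoff w • (F w * ξ)) (hφd.smul (hFd.mul_const' ξ))
  rw [jac, hU, hFd.fderiv]
  have h5 : Real.exp (Complex.log z).re = ‖z‖ := by
    rw [Complex.log_re, Real.exp_log (zero_lt_one.trans h1)]
  have h6 : (z⁻¹.re ^ 2 + z⁻¹.im ^ 2) * ‖z‖ ^ 2 = 1 := by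
    rw [← Complex.normSq_eq_norm_sq]
    have := Complex.normSq_mul z⁻¹ z
    rw [inv_mul_cancel₀ hz0, map_one, Complex.normSq_apply z⁻¹] at this
    linarith
  -- Both derivatives of `F` are multiples of `G'`, so the terms in which the cut-off is not
  -- differentiated vanish.
  have h7 := inner_mul_im_self hξ G'
  have h8 : Complex.I * z⁻¹ = ⟨-z⁻¹.im, z⁻¹.re⟩ := by apply Complex.ext <;> simp
  have e1 : lz 1 = z⁻¹ := by simp [hlz]
  have e2 : lz Complex.I = ⟨-z⁻¹.im, z⁻¹.re⟩ := by rw [← h8]; simp [hlz]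
  rw [real_inner_comm (F z * ξ) G']
  simp only [add_apply, smul_apply, neg_apply, ContinuousLinearMap.smulRight_apply,
    ContinuousLinearMap.comp_apply, Complex.imCLM_apply, Complex.reCLM_apply, e1, e2, h5,
    inner_add_left, real_inner_smul_left, real_inner_smul_right, smul_eq_mul,
    MulOpposite.smul_eq_mul_unop, MulOpposite.unop_op, smul_mul_assoc, h7]
  generalize z⁻¹.re = c at *
  generalize z⁻¹.im = d at *
  linear_combination (-inner ℝ (F z * ξ) G') * h6

theorem IsLip.comp_exp {F : ℂ → ℍ[ℝ]} (hF : IsLip F) :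
    IsLip fun θ : ℝ => F (Complex.exp (θ * Complex.I)) := by
  have h : IsLip (circleMap 0 1) := ⟨_, lipschitzWith_circleMap 0 1⟩
  simpa [circleMap] using hF.comp h

/-- Cutting `F ξ` off outside the disc makes the total integral zero. The annulus `1 < |z| < 2` has
radial length `1` and contributes exactly minus the boundary integral, so no trace on the circle has
to be taken. -/
theorem integral_jac_disc {F : ℂ → ℍ[ℝ]} (hF : IsLip F) (hF1 : ∀ z, ‖F z‖ = 1)
    (hr : ∀ z, F (retr z) = F z) {ξ : ℍ[ℝ]} (hξ : ξ ∈ S2) :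
    ∫ z in disc, jac (fun w => F w * ξ) F z = ∫ θ in Ioo (-Real.pi) Real.pi,
      inner ℝ (deriv (fun θ : ℝ => F (Complex.exp (θ * Complex.I))) θ)
        (F (Complex.exp (θ * Complex.I)) * ξ) := by
  set U : ℂ → ℍ[ℝ] := fun w => cutoff w • (F w * ξ) with hU
  set G : ℝ → ℍ[ℝ] := fun θ => F (Complex.exp (θ * Complex.I)) with hG
  have hbd : ∀ z, ‖F z * ξ‖ ≤ 1 := fun z => by rw [norm_mul, hF1, hξ.2, one_mul]
  have hUl : IsLip U := isLip_cutoff.smul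
    (hF.mul (isLip_const ξ) (fun z => (hF1 z).le) (fun _ => hξ.2.le)) norm_cutoff_le hbd
  have hcs : HasCompactSupport U := by
    refine HasCompactSupport.intro (isCompact_closedBall (0 : ℂ) 2) fun z hz => ?_
    rw [mem_closedBall_zero_iff, not_le] at hz
    simp [hU, cutoff_eq_zero hz.le]
  obtain ⟨hint, hzero⟩ := integrable_jac hUl hcs hF
  have hmeas : MeasurableSet disc := Metric.isClosed_closedBall.measurableSet
  have h1 : ∫ z in disc, jac U F z = ∫ z in disc, jac (fun w => F w * ξ) F z := by
    refine setIntegral_congr_ae hmeas ?_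
    have hs : ∀ᵐ z : ℂ, z ∉ Metric.sphere (0 : ℂ) 1 :=
      measure_eq_zero_iff_ae_notMem.1 (Measure.addHaar_sphere _ _ _)
    filter_upwards [hs] with z hz hzd
    have hlt : ‖z‖ < 1 := lt_of_le_of_ne (by simpa [disc] using hzd) (by simpa using hz)
    refine jac_congr_left ?_
    filter_upwards [continuous_norm.continuousAt.eventually_lt_const hlt] with w hw
    simp [hU, cutoff_eq_one hw.le]
  have h2 : ∫ z in discᶜ, jac U F z =
      - ∫ θ in Ioo (-Real.pi) Real.pi, inner ℝ (deriv G θ) (G θ * ξ) := by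
    rw [← integral_indicator hmeas.compl, ← Complex.integral_comp_polarCoord_symm,
      polarCoord_target, Measure.volume_eq_prod]
    have hGl : IsLip G := hF.comp_exp
    have hae : ∀ᵐ p : ℝ × ℝ ∂(volume.prod volume),
        DifferentiableAt ℝ G p.2 :=
      Measure.quasiMeasurePreserving_snd.ae hGl.choose_spec.ae_differentiableAt
    have hae2 : ∀ᵐ p : ℝ × ℝ ∂(volume.prod volume), p.1 ≠ 2 :=
      Measure.quasiMeasurePreserving_fst.ae (Measure.ae_ne volume 2)
    calc _ = ∫ p in Ioi (0 : ℝ) ×ˢ Ioo (-Real.pi) Real.pi, (Ioo (1 : ℝ) 2).indicator 1 p.1 *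
          (- inner ℝ (deriv G p.2) (G p.2 * ξ)) ∂(volume.prod volume) := by
          refine setIntegral_congr_ae (measurableSet_Ioi.prod measurableSet_Ioo) ?_
          filter_upwards [hae, hae2] with p hp1 hp2 hp
          have hp0 : 0 < p.1 := hp.1
          have hn : ‖Complex.polarCoord.symm p‖ = p.1 := by
            rw [Complex.norm_polarCoord_symm, abs_of_pos hp0]
          have hpt : p ∈ Complex.polarCoord.target := by rwa [Complex.polarCoord_target]
          have hz : Complex.polarCoord.symm p ∈ Complex.slitPlane :=
            Complex.polarCoord.map_target hpt
          have harg : (Complex.polarCoord.symm p).arg = p.2 := by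
            have := Complex.polarCoord.right_inv (x := p) hpt
            rw [Complex.polarCoord_apply] at this
            exact congrArg Prod.snd this
          have hFG : 1 < p.1 → F (Complex.polarCoord.symm p) = G p.2 := fun h => by
            rw [← hr, retr_of_le_norm (by rw [hn]; exact h.le), hn, Complex.polarCoord_symm_apply]
            simp only [hG]
            have : (p.1 : ℂ) ≠ 0 := by exact_mod_cast hp0.ne'
            rw [Complex.exp_mul_I, Complex.real_smul, Complex.ofReal_inv, inv_mul_cancel_left₀ this,
              Complex.ofReal_cos, Complex.ofReal_sin]
          rcases le_or_gt p.1 1 with h | h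
          · rw [indicator_of_notMem (by
              rw [disc, mem_compl_iff, mem_closedBall_zero_iff, hn]; simpa using h),
              indicator_of_notMem (by simp [h])]
            simp
          rw [indicator_of_mem (by rw [disc, mem_compl_iff, mem_closedBall_zero_iff, hn]; simpa using h)]
          rcases lt_or_gt_of_ne hp2 with h' | h'
          · rw [indicator_of_mem (show p.1 ∈ Ioo (1 : ℝ) 2 from ⟨h, h'⟩)]
            have := jac_cutoff_annulus hr hξ.1 hz (by rwa [hn]) (by rwa [hn])
              (by rw [harg]; exact hp1.hasDerivAt)
            rw [hn, hFG h] at this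
            simpa using this
          · rw [indicator_of_notMem (by simp [h'.le])]
            rw [jac_congr_left (V := fun _ => 0)]
            · simp [jac]
            · rw [← hn] at h'
              filter_upwards [continuous_norm.continuousAt.eventually_const_lt h'] with w hw
              simp [hU, cutoff_eq_zero hw.le]
      _ = _ := by
          have hsub : Ioo (1 : ℝ) 2 ⊆ Ioi 0 := fun x hx => zero_lt_one.trans hx.1
          rw [setIntegral_prod_mul (fun r : ℝ => (Ioo (1 : ℝ) 2).indicator 1 r)
              (fun θ => -inner ℝ (deriv G θ) (G θ * ξ)), integral_indicator measurableSet_Ioo,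
            Measure.restrict_restrict measurableSet_Ioo, integral_neg,
            inter_eq_left.2 hsub]
          simp
          norm_num
  have h3 := integral_add_compl hmeas hint
  rw [hzero, h1, h2] at h3
  linarith

/-! ### Curvature of the Hopf connection -/

instance starModule_quaternion : StarModule ℝ ℍ[ℝ] :=
  ⟨fun r x => by ext <;> simp⟩

theorem star_mul_self_of_norm {y : ℍ[ℝ]} (hy : ‖y‖ = 1) : star y * y = 1 := by
  rw [Quaternion.star_mul_self, Quaternion.normSq_eq_norm_mul_self, hy]; simp

theorem mul_star_self_of_norm {y : ℍ[ℝ]} (hy : ‖y‖ = 1) : y * star y = 1 := by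
  rw [Quaternion.self_mul_star, Quaternion.normSq_eq_norm_mul_self, hy]; simp

theorem inner_mul_mul_left {y : ℍ[ℝ]} (hy : ‖y‖ = 1) (a b : ℍ[ℝ]) :
    inner ℝ (y * a) (y * b) = inner ℝ a b := by
  have h1 : ∀ c : ℍ[ℝ], ‖y * c‖ = ‖c‖ := fun c => by rw [norm_mul, hy, one_mul]
  rw [real_inner_eq_norm_add_mul_self_sub_norm_mul_self_sub_norm_mul_self_div_two, ← mul_add,
    h1, h1, h1, ← real_inner_eq_norm_add_mul_self_sub_norm_mul_self_sub_norm_mul_self_div_two]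

theorem inner_mul_mul_right {y : ℍ[ℝ]} (hy : ‖y‖ = 1) (a b : ℍ[ℝ]) :
    inner ℝ (a * y) (b * y) = inner ℝ a b := by
  have h1 : ∀ c : ℍ[ℝ], ‖c * y‖ = ‖c‖ := fun c => by rw [norm_mul, hy, mul_one]
  rw [real_inner_eq_norm_add_mul_self_sub_norm_mul_self_sub_norm_mul_self_div_two, ← add_mul,
    h1, h1, h1, ← real_inner_eq_norm_add_mul_self_sub_norm_mul_self_sub_norm_mul_self_div_two]

theorem re_star_mul (a b : ℍ[ℝ]) : (star a * b).re = inner ℝ a b := by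
  rw [inner_eq_components]; simp

/-- For imaginary `a` the commutator is `2 a × ξ`, and `a ↦ a × ξ` is projection to `ξ^⊥` followed
by a quarter turn. Both sides therefore equal `4σ ⟪ξ, a × b⟫`. -/
theorem areaForm_commutator (σ : ℤˣ) {ξ a b : ℍ[ℝ]} (hξ : ξ ∈ S2) (ha : a.re = 0)
    (hb : b.re = 0) :
    areaForm σ ξ (a * ξ - ξ * a) (b * ξ - ξ * b) =
      -(2 * (σ : ℤ)) * (inner ℝ (a * ξ) b - inner ℝ (b * ξ) a) := by
  have h1 : ξ.imI ^ 2 + ξ.imJ ^ 2 + ξ.imK ^ 2 = 1 := by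
    have := inner_eq_components ξ ξ
    rw [real_inner_self_eq_norm_sq, hξ.2, hξ.1] at this
    linarith
  simp only [areaForm, inner_eq_components]
  simp [hξ.1, ha, hb]
  linear_combination (4 * ((σ : ℤ) : ℝ) * (ξ.imI * (a.imJ * b.imK - a.imK * b.imJ) +
    ξ.imJ * (a.imK * b.imI - a.imI * b.imK) + ξ.imK * (a.imI * b.imJ - a.imJ * b.imI))) * h1

/-- The Hopf projection pulls the area form back to a multiple of the curvature of the
connection form. -/
theorem areaForm_hopf (σ : ℤˣ) {ξ y v w : ℍ[ℝ]} (hξ : ξ ∈ S2) (hy : ‖y‖ = 1)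
    (hv : inner ℝ y v = 0) (hw : inner ℝ y w = 0) :
    areaForm σ (y * ξ * star y) (v * ξ * star y + y * ξ * star v)
      (w * ξ * star y + y * ξ * star w) =
      -(2 * (σ : ℤ)) * (inner ℝ (v * ξ) w - inner ℝ (w * ξ) v) := by
  have hys := star_mul_self_of_norm hy
  have hy' : ‖star y‖ = 1 := by rw [norm_star, hy]
  -- Left translation by `y`, and conjugation by `y` on the sphere, preserve all terms and reduce
  -- the claim to the point `1`, where tangent vectors are imaginary.
  obtain ⟨a, rfl⟩ : ∃ a, v = y * a := ⟨star y * v, by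
    rw [← mul_assoc, mul_star_self_of_norm hy, one_mul]⟩
  obtain ⟨b, rfl⟩ : ∃ b, w = y * b := ⟨star y * w, by
    rw [← mul_assoc, mul_star_self_of_norm hy, one_mul]⟩
  have hre : ∀ c, inner ℝ y (y * c) = 0 → c.re = 0 := fun c hc => by
    rwa [← re_star_mul, ← mul_assoc, hys, one_mul] at hc
  have hst : ∀ c : ℍ[ℝ], c.re = 0 → star c = -c := fun c hc => by
    rw [Quaternion.star_eq_two_re_sub, hc]; simp
  have ha := hre a hv
  have hb := hre b hw
  have e : ∀ c : ℍ[ℝ], c.re = 0 → y * c * ξ * star y + y * ξ * star (y * c) =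
      y * (c * ξ - ξ * c) * star y := fun c hc => by
    rw [star_mul, hst c hc]; noncomm_ring
  have e2 : ∀ m n : ℍ[ℝ], y * m * star y * (y * n * star y) = y * (m * n) * star y :=
    fun m n => by
      rw [show y * m * star y * (y * n * star y) = y * m * (star y * y) * n * star y by
        noncomm_ring, hys]
      noncomm_ring
  have e3 : ∀ x m n : ℍ[ℝ], areaForm σ (y * x * star y) (y * m * star y) (y * n * star y) =
      areaForm σ x m n := fun x m n => by
    rw [areaForm, e2, e2, ← sub_mul, ← mul_sub, inner_mul_mul_right hy', inner_mul_mul_left hy,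
      areaForm]
  rw [e a ha, e b hb, e3, areaForm_commutator σ hξ ha hb, mul_assoc, mul_assoc,
    inner_mul_mul_left hy, inner_mul_mul_left hy]

theorem inner_fderiv_eq_zero {E : Type*} [NormedAddCommGroup E] [NormedSpace ℝ E]
    {F : E → ℍ[ℝ]} (hF1 : ∀ z, ‖F z‖ = 1) {z : E} {F' : E →L[ℝ] ℍ[ℝ]}
    (h : HasFDerivAt F F' z) (v : E) : inner ℝ (F z) (F' v) = 0 := by
  have h1 := h.norm_sq
  have h2 : (fun w => ‖F w‖ ^ 2) = fun _ => 1 := by ext w; simp [hF1]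
  rw [h2] at h1
  have := congrArg (fun L => L v) (h1.unique (hasFDerivAt_const _ _))
  simpa using this

theorem eq_mul_star_of_mul_eq {ξ x y : ℍ[ℝ]} (hy : ‖y‖ = 1) (h : y * ξ = x * y) :
    x = y * ξ * star y := by
  rw [h, mul_assoc, mul_star_self_of_norm hy, mul_one]

/-- Near an interior point `f = F ξ F*`, so the product rule and `areaForm_hopf` apply wherever `F`
is differentiable. The boundary circle, where `fderiv` of `f` is not controlled, is a null set. -/
theorem pullbackArea_eq_integral_jac (σ : ℤˣ) {ξ : ℍ[ℝ]} (hξ : ξ ∈ S2) {f F : ℂ → ℍ[ℝ]}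
    (hF : IsLip F) (hF1 : ∀ z, ‖F z‖ = 1) (hFξ : ∀ z, F z * ξ = f (retr z) * F z) :
    pullbackArea σ f = -(2 * (σ : ℤ)) * ∫ z in disc, jac (fun w => F w * ξ) F z := by
  rw [pullbackArea, ← integral_const_mul]
  refine setIntegral_congr_ae Metric.isClosed_closedBall.measurableSet ?_
  have hs : ∀ᵐ z : ℂ, z ∉ Metric.sphere (0 : ℂ) 1 :=
    measure_eq_zero_iff_ae_notMem.1 (Measure.addHaar_sphere _ _ _)
  filter_upwards [hs, hF.choose_spec.ae_differentiableAt] with z hz hd hzd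
  have hlt : ‖z‖ < 1 := lt_of_le_of_ne (by simpa [disc] using hzd) (by simpa using hz)
  have heq : f =ᶠ[𝓝 z] fun w => F w * ξ * star (F w) := by
    filter_upwards [continuous_norm.continuousAt.eventually_lt_const hlt] with w hw
    have := eq_mul_star_of_mul_eq (hF1 w) (hFξ w)
    rwa [retr_of_norm_le hw.le] at this
  have hdF := hd.hasFDerivAt
  have hdU := hdF.mul_const' ξ
  have hdf := HasFDerivAt.fderiv (f := fun w => F w * ξ * star (F w)) (hdU.mul' hdF.star)
  have hdU' := HasFDerivAt.fderiv (f := fun w => F w * ξ) hdU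
  rw [heq.fderiv_eq, heq.eq_of_nhds, hdf, jac, hdU']
  have := areaForm_hopf σ hξ (hF1 z) (inner_fderiv_eq_zero hF1 hdF 1)
    (inner_fderiv_eq_zero hF1 hdF Complex.I)
  simpa [add_comm, starL'_apply] using this

/-! ### Holonomy of horizontal lifts -/

/-- The hypothesis says `k × ξ = 0`, and `k - ⟪k, ξ⟫ ξ = ξ × (k × ξ)` for unit `ξ`. -/
theorem eq_inner_smul_of_commute {ξ k : ℍ[ℝ]} (hξ : ξ ∈ S2) (hk : k.re = 0)
    (h : k * ξ = ξ * k) : k = inner ℝ k ξ • ξ := by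
  have h1 := inner_eq_components ξ ξ
  rw [real_inner_self_eq_norm_sq, hξ.2, hξ.1] at h1
  have h2 := congrArg QuaternionAlgebra.imI h
  have h3 := congrArg QuaternionAlgebra.imJ h
  have h4 := congrArg QuaternionAlgebra.imK h
  simp [hξ.1, hk] at h2 h3 h4
  rw [inner_eq_components]
  ext
  · simp [hξ.1, hk]
  · simp [hk]
    linear_combination k.imI * h1 + ξ.imJ / 2 * h4 - ξ.imK / 2 * h3
  · simp [hk]
    linear_combination k.imJ * h1 - ξ.imI / 2 * h4 + ξ.imK / 2 * h2
  · simp [hk]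
    linear_combination k.imK * h1 + ξ.imI / 2 * h3 - ξ.imJ / 2 * h2

/-- The velocity of the difference of a lift `g` and a horizontal lift `c` of the same curve. -/
theorem vertical_velocity {ξ g g' c c' : ℍ[ℝ]} (hξ : ξ ∈ S2) (hg : ‖g‖ = 1) (hc : ‖c‖ = 1)
    (hg' : inner ℝ g g' = 0) (hc' : inner ℝ c c' = 0) (hor : inner ℝ c' (c * ξ) = 0)
    (h0 : star g * c * ξ = ξ * (star g * c))
    (h1 : (star g' * c + star g * c') * ξ = ξ * (star g' * c + star g * c')) :
    star g' * c + star g * c' = -inner ℝ g' (g * ξ) • (star g * c * ξ) := by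
  obtain ⟨u, rfl⟩ : ∃ u, c = g * u := ⟨star g * c, by
    rw [← mul_assoc, mul_star_self_of_norm hg, one_mul]⟩
  have hu : ‖u‖ = 1 := by rwa [norm_mul, hg, one_mul] at hc
  obtain ⟨m, rfl⟩ : ∃ m, g' = g * m := ⟨star g * g', by
    rw [← mul_assoc, mul_star_self_of_norm hg, one_mul]⟩
  obtain ⟨n, rfl⟩ : ∃ n, c' = g * u * n := ⟨star (g * u) * c', by
    rw [← mul_assoc, mul_star_self_of_norm hc, one_mul]⟩
  have hgs := star_mul_self_of_norm hg
  have hus := star_mul_self_of_norm hu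
  have hsu := mul_star_self_of_norm hu
  have e0 : star g * (g * u) = u := by rw [← mul_assoc, hgs, one_mul]
  have hm : m.re = 0 := by rwa [← re_star_mul, ← mul_assoc, hgs, one_mul] at hg'
  have hn : n.re = 0 := by
    rwa [← re_star_mul, ← mul_assoc, star_mul_self_of_norm hc, one_mul] at hc'
  have hms : star m = -m := by rw [Quaternion.star_eq_two_re_sub, hm]; simp
  have e1 : star (g * m) * (g * u) + star g * (g * u * n) = u * (n - star u * m * u) := by
    rw [star_mul, hms, mul_assoc (-m), e0, ← mul_assoc (star g), e0, mul_sub,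
      show u * (star u * m * u) = u * star u * m * u by noncomm_ring, hsu]
    noncomm_ring
  rw [e0] at h0 ⊢
  rw [e1] at h1 ⊢
  rw [inner_mul_mul_left hc] at hor
  -- The velocity is `u k` with `k` imaginary and commuting with `ξ`, so `k = ⟪k, ξ⟫ ξ`.
  -- Horizontality gives `⟪n, ξ⟫ = 0`, and conjugation by `u` fixes `ξ`, which leaves `-⟪m, ξ⟫`.
  set k := n - star u * m * u with hk
  have hk0 : k.re = 0 := by
    have : (star u * m * u).re = 0 := by
      rw [mul_assoc, re_star_mul]
      have h2 := inner_mul_mul_right hu 1 m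
      rw [one_mul] at h2
      rw [h2, ← re_star_mul, star_one, one_mul, hm]
    rw [hk, Quaternion.re_sub, hn, this, sub_zero]
  have hkξ : k * ξ = ξ * k := by
    have : u * (k * ξ) = u * (ξ * k) := by
      rw [← mul_assoc, h1, ← mul_assoc, ← h0, mul_assoc]
    have h2 := congrArg (star u * ·) this
    simpa only [← mul_assoc, hus, one_mul] using h2
  have hin : inner ℝ k ξ = - inner ℝ (g * m) (g * ξ) := by
    rw [hk, inner_sub_left, hor, inner_mul_mul_left hg, zero_sub, neg_inj]
    have : ξ = star u * ξ * u := by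
      rw [mul_assoc, ← h0, ← mul_assoc, hus, one_mul]
    conv_lhs => rw [this]
    rw [inner_mul_mul_right hu, inner_mul_mul_left (by rw [norm_star, hu])]
  rw [eq_inner_smul_of_commute hξ hk0 hkξ, hin, mul_smul_comm]

theorem isLip_exp_smul {ξ : ℍ[ℝ]} (hξ : ξ ∈ S2) :
    IsLip fun s : ℝ => NormedSpace.exp (s • ξ) := by
  refine ⟨1, lipschitzWith_of_nnnorm_deriv_le
    (fun s => (hasDerivAt_exp_smul_const ξ s).differentiableAt) fun s => ?_⟩
  rw [(hasDerivAt_exp_smul_const ξ s).deriv, ← NNReal.coe_le_coe, coe_nnnorm, norm_mul, hξ.2,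
    Quaternion.norm_exp]
  simp [hξ.1]

theorem norm_exp_smul {ξ : ℍ[ℝ]} (hξ : ξ ∈ S2) (s : ℝ) : ‖NormedSpace.exp (s • ξ)‖ = 1 := by
  rw [Quaternion.norm_exp]; simp [hξ.1]

theorem exp_add_smul (ξ : ℍ[ℝ]) (s t : ℝ) :
    NormedSpace.exp ((s + t) • ξ) = NormedSpace.exp (s • ξ) * NormedSpace.exp (t • ξ) := by
  let _ := NormedAlgebra.restrictScalars ℚ ℝ ℍ[ℝ]
  rw [add_smul, NormedSpace.exp_add_of_commute
    (((Commute.refl ξ).smul_left s).smul_right t)]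

theorem exp_two_pi_int_smul {ξ : ℍ[ℝ]} (hξ : ξ ∈ S2) (k : ℤ) :
    NormedSpace.exp ((2 * Real.pi * k) • ξ) = 1 := by
  have hn : ‖(2 * Real.pi * k) • ξ‖ = |k * (2 * Real.pi)| := by
    rw [norm_smul, hξ.2, mul_one, Real.norm_eq_abs, mul_comm]
  have hs : Real.sin |k * (2 * Real.pi)| = 0 := by
    have h0 : Real.sin (k * (2 * Real.pi)) = 0 := by
      have h := Real.sin_int_mul_pi (k * 2)
      rwa [Int.cast_mul, Int.cast_ofNat, mul_assoc] at h
    rcases abs_choice (k * (2 * Real.pi)) with h | h <;> simp only [h, Real.sin_neg, h0, neg_zero]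
  rw [Quaternion.exp_of_re_eq_zero _ (by simp [hξ.1]), hn, Real.cos_abs,
    Real.cos_int_mul_two_pi, hs]
  simp

/-- Comparison of a horizontal lift `c` with a Lipschitz lift `g` of the same curve: along
`[x, y]` they drift apart by the integral of the connection form along `g`. -/
theorem horizontal_lift_drift {ξ : ℍ[ℝ]} (hξ : ξ ∈ S2) {γ g c : ℝ → ℍ[ℝ]} (hg : IsLip g)
    (hg1 : ∀ t, ‖g t‖ = 1) (hgξ : ∀ t, g t * ξ = γ t * g t) (hc : IsHorizontalLift ξ γ c)
    (x y : ℝ) :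
    star (g y) * c y * NormedSpace.exp ((∫ t in x..y, inner ℝ (deriv g t) (g t * ξ)) • ξ) =
      star (g x) * c x := by
  obtain ⟨⟨hcs, hc1, hhor⟩, hclift⟩ := hc
  replace hc1 : ∀ t, ‖c t‖ = 1 := hc1
  set β : ℝ → ℝ := fun t => inner ℝ (deriv g t) (g t * ξ) with hβ
  have hcomm : ∀ t, star (g t) * c t * ξ = ξ * (star (g t) * c t) := fun t => by
    have h1 : c t * ξ = γ t * c t := by
      have hne : c t ≠ 0 := norm_ne_zero_iff.1 (by rw [hc1]; exact one_ne_zero)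
      rw [← hclift t, hopf, mul_assoc, inv_mul_cancel₀ hne, mul_one]
    have h2 : star (g t) * γ t = ξ * star (g t) := by
      rw [eq_mul_star_of_mul_eq (hg1 t) (hgξ t), ← mul_assoc, ← mul_assoc,
        star_mul_self_of_norm (hg1 t), one_mul]
    rw [mul_assoc, h1, ← mul_assoc, h2, mul_assoc]
  obtain ⟨C, hC⟩ := id hg
  have hβC : ∀ t, ‖β t‖ ≤ C := fun t => by
    refine (norm_inner_le_norm _ _).trans ?_
    rw [norm_mul, hg1, hξ.2, mul_one, mul_one]
    exact norm_deriv_le_of_lipschitz hC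
  have hβm : AEStronglyMeasurable β volume :=
    (aestronglyMeasurable_deriv g volume).inner
      ((hg.continuous.mul continuous_const).aestronglyMeasurable)
  have hβl : LocallyIntegrable β volume :=
    (memLp_top_of_bound hβm C (.of_forall hβC)).locallyIntegrable le_top
  have hβi : ∀ a b, IntervalIntegrable β volume a b := fun a b =>
    (hβl.integrableOn_isCompact isCompact_uIcc).intervalIntegrable
  set J : ℝ → ℝ := fun t => ∫ s in x..t, β s with hJ
  have hJl : IsLip J := .of_norm_sub_le C fun a b => by
    rw [hJ, intervalIntegral.integral_interval_sub_left (hβi _ _) (hβi _ _), Real.dist_eq]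
    exact intervalIntegral.norm_integral_le_of_norm_le_const fun t _ => hβC t
  -- The exponential is the integrating factor for `u' = -β u ξ`, where `u = star g * c`. Since `g`
  -- is only Lipschitz, `W' = 0` holds almost everywhere, and absolute continuity is needed to
  -- conclude that `W` is constant.
  set W : ℝ → ℍ[ℝ] := fun t => star (g t) * c t * NormedSpace.exp (J t • ξ) with hW
  have hWl : ∃ K, LipschitzOnWith K W (uIcc x y) := by
    obtain ⟨D, hD⟩ : ∃ D, LipschitzOnWith D c (uIcc x y) :=
      (hcs.of_le (by simp)).contDiffOn.exists_lipschitzOnWith (n := 1) (by simp)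
        (convex_uIcc x y) isCompact_uIcc
    have h1 : IsLip fun t : uIcc x y => star (g t) :=
      IsLip.comp (g := fun q : ℍ[ℝ] => star q) ⟨1, LipschitzWith.of_dist_le_mul fun a b => by
        rw [dist_eq_norm, ← star_sub, norm_star, dist_eq_norm]; simp⟩
        (hg.comp ⟨1, LipschitzWith.subtype_val _⟩)
    have h2 : IsLip fun t : uIcc x y => c t := ⟨D, lipschitzOnWith_iff_restrict.1 hD⟩
    have h3 : IsLip fun t : uIcc x y => NormedSpace.exp (J t • ξ) :=
      (isLip_exp_smul hξ).comp (hJl.comp ⟨1, LipschitzWith.subtype_val _⟩)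
    have hb1 : ∀ t, ‖star (g t)‖ ≤ 1 := fun t => by rw [norm_star, hg1]
    have hb2 : ∀ t, ‖star (g t) * c t‖ ≤ 1 := fun t => by
      rw [norm_mul, norm_star, hg1, hc1, one_mul]
    obtain ⟨K, hK⟩ := (h1.mul h2 (fun t => hb1 t) (fun t => (hc1 t).le)).mul h3
      (fun t => hb2 t) (fun t => (norm_exp_smul hξ _).le)
    exact ⟨K, lipschitzOnWith_iff_restrict.2 hK⟩
  have hd : ∀ᵐ t, t ∈ uIcc x y → HasDerivAt W 0 t := by
    filter_upwards [hC.ae_differentiableAt,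
      _root_.LocallyIntegrable.ae_hasDerivAt_integral hβl] with t ht1 ht2 _
    have hgd := ht1.hasDerivAt
    have hcd := (hcs.differentiable (by simp) t).hasDerivAt
    have hud := hgd.star.mul hcd
    have hcomm' : (star (deriv g t) * c t + star (g t) * deriv c t) * ξ =
        ξ * (star (deriv g t) * c t + star (g t) * deriv c t) := by
      refine HasDerivAt.unique (hud.mul_const ξ) ?_
      refine (hud.const_mul ξ).congr_of_eventuallyEq (.of_forall fun s => ?_)
      exact hcomm s
    have hvel := vertical_velocity hξ (hg1 t) (hc1 t)
      (by simpa using inner_fderiv_eq_zero hg1 hgd.hasFDerivAt 1)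
      (by simpa using inner_fderiv_eq_zero hc1 hcd.hasFDerivAt 1) (hhor t) (hcomm t) hcomm'
    have hed : HasDerivAt (fun s => NormedSpace.exp (J s • ξ))
        (β t • (ξ * NormedSpace.exp (J t • ξ))) t := by
      have := (hasDerivAt_exp_smul_const' ξ (J t)).scomp t (ht2 x)
      exact this
    have hWd := hud.mul hed
    rw [hvel] at hWd
    have e : -β t • (star (g t) * c t * ξ) * NormedSpace.exp (J t • ξ) +
        star (g t) * c t * (β t • (ξ * NormedSpace.exp (J t • ξ))) = 0 := by
      rw [smul_mul_assoc, mul_smul_comm, neg_smul, ← mul_assoc, neg_add_cancel]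
    rw [← e]
    exact hWd
  obtain ⟨K, hK⟩ := hWl
  obtain ⟨k, hk⟩ := hK.absolutelyContinuousOnInterval.const_of_ae_hasDerivAt_zero hd
  have h1 := hk x left_mem_uIcc
  have h2 := hk y right_mem_uIcc
  rw [← h1] at h2
  simpa [hW, hJ] using h2

/-- The holonomy of the Hopf connection along the boundary of a disc `f` is half the area of `f`
(for the orientation `σ = -1`). -/
theorem holonomy_eq_area {ξ : ℍ[ℝ]} (hξ : ξ ∈ S2) {γ c : ℝ → ℍ[ℝ]} {p : ℝ} (hp : 0 < p)
    (hc : IsHorizontalLift ξ γ c) {f : ℂ → ℍ[ℝ]} (hf : IsDiscExtension γ p f) :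
    ∃ A : ℝ, (∀ σ : ℤˣ, pullbackArea σ f = -(2 * (σ : ℤ)) * A) ∧
      ∀ x, c (x + p) * NormedSpace.exp (A • ξ) = c x := by
  obtain ⟨hpw, hfS, hfγ⟩ := hf
  obtain ⟨L, hL⟩ := hpw.exists_lipschitzOnWith
  have hc1 : ∀ t, ‖c t‖ = 1 := hc.1.2.1
  have hf1 : f 1 = γ 0 := by simpa using hfγ 0
  have h₀ : c 0 * ξ = f 1 * c 0 := by
    have hne : c 0 ≠ 0 := norm_ne_zero_iff.1 (by rw [hc1]; exact one_ne_zero)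
    rw [hf1, ← hc.2 0, hopf, mul_assoc, inv_mul_cancel₀ hne, mul_one]
  -- The starting value `c 0` is available because it lies over `γ 0 = f 1`.
  obtain ⟨F, hF, hF1, hFξ, hFr⟩ := exists_isLip_lift hL hfS (hc1 0) h₀
  refine ⟨_, fun σ => pullbackArea_eq_integral_jac σ hξ hF hF1 hFξ, fun x => ?_⟩
  rw [integral_jac_disc hF hF1 hFr hξ]
  set G : ℝ → ℍ[ℝ] := fun θ => F (Complex.exp (θ * Complex.I)) with hG
  set g : ℝ → ℍ[ℝ] := fun t => G (2 * Real.pi / p * t) with hg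
  have hGl : IsLip G := hF.comp_exp
  have hgl : IsLip g := hGl.comp (g := G) (.of_norm_sub_le |2 * Real.pi / p| fun a b => by
    rw [← mul_sub, norm_mul, Real.norm_eq_abs, dist_eq_norm])
  have hgξ : ∀ t, g t * ξ = γ t * g t := fun t => by
    have h1 : ((2 * Real.pi / p * t : ℝ) : ℂ) * Complex.I =
        2 * Real.pi * (t / p : ℝ) * Complex.I := by push_cast; ring
    have h2 := hFξ (Complex.exp ((2 * Real.pi / p * t : ℝ) * Complex.I))
    rw [retr_of_norm_le (Complex.norm_exp_ofReal_mul_I _).le] at h2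
    nth_rw 2 [h1] at h2
    rwa [hfγ, mul_div_cancel₀ _ hp.ne'] at h2
  have hGper : Function.Periodic G (2 * Real.pi) := fun θ => by
    simp only [hG]
    congr 1
    push_cast
    rw [add_mul, Complex.exp_periodic]
  have hgper : Function.Periodic g p := fun t => by
    simp only [hg]
    rw [mul_add, div_mul_cancel₀ _ hp.ne', hGper]
  have hβper : Function.Periodic (fun t => inner ℝ (deriv g t) (g t * ξ)) p := fun t => by
    have h1 : deriv g (t + p) = deriv g t := by
      rw [← deriv_comp_add_const]
      congr 1
      ext1 s
      exact hgper s
    simp only [h1, hgper t]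
  have hint : ∫ t in x..(x + p), inner ℝ (deriv g t) (g t * ξ) =
      ∫ θ in Ioo (-Real.pi) Real.pi, inner ℝ (deriv G θ) (G θ * ξ) := by
    -- By periodicity the period may start at `-p / 2`, which rescales to the range `(-π, π)` of the
    -- argument.
    rw [hβper.intervalIntegral_add_eq x (-(p / 2)), ← integral_Ioc_eq_integral_Ioo,
      ← intervalIntegral.integral_of_le (by linarith [Real.pi_pos])]
    have h1 : ∀ t, inner ℝ (deriv g t) (g t * ξ) = 2 * Real.pi / p *
        (fun θ => inner ℝ (deriv G θ) (G θ * ξ)) (2 * Real.pi / p * t) := fun t => by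
      simp only [hg]
      rw [deriv_comp_mul_left, real_inner_smul_left]
    simp_rw [h1]
    rw [intervalIntegral.integral_const_mul,
      intervalIntegral.mul_integral_comp_mul_left (f := fun θ => inner ℝ (deriv G θ) (G θ * ξ))]
    congr 1 <;> field_simp <;> ring
  have hdrift := horizontal_lift_drift hξ hgl (fun t => hF1 _) hgξ hc x (x + p)
  rw [hint, hgper x, mul_assoc] at hdrift
  have h3 := congrArg (g x * ·) hdrift
  have hgg : g x * star (g x) = 1 := mul_star_self_of_norm (hF1 _)
  simpa only [← mul_assoc, hgg, one_mul] using h3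

end HopfLift

end

/-! ### From area to quasiperiodicity -/

theorem mainTheorem3 (ξ : ℍ[ℝ]) (hξ : ξ ∈ HopfLift.S2)
    (γ : ℝ → ℍ[ℝ]) (hγ : ContDiff ℝ ∞ γ) (hγS : ∀ t, γ t ∈ HopfLift.S2)
    (p : ℝ) (hp : 0 < p) (hper : Function.Periodic γ p)
    (γhat : ℝ → ℍ[ℝ]) (hlift : HopfLift.IsHorizontalLift ξ γ γhat)
    (q : ℝ) (σ : ℤˣ)
    (harea : HopfLift.IsSignedArea σ γ p ((-(4 * Real.pi * q) : ℝ) : AddCircle (4 * Real.pi))) :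
    HopfLift.IsQuasiperiodic ξ q γhat ∧
      (σ = -1 → ∀ x, γhat (x + p) = γhat x * NormedSpace.exp ((2 * Real.pi * q) • ξ)) ∧
      (σ = 1 → ∀ x, γhat (x - p) = γhat x * NormedSpace.exp ((2 * Real.pi * q) • ξ)) := by
  obtain ⟨f, hf, hA⟩ := harea
  obtain ⟨A, hfA, hhol⟩ := HopfLift.holonomy_eq_area hξ hp hlift hf
  rw [hfA, ← sub_eq_zero, ← AddCircle.coe_sub, AddCircle.coe_eq_zero_iff] at hA
  obtain ⟨n, hn⟩ := hA
  rw [zsmul_eq_mul] at hn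
  -- Halving the congruence modulo `4π` leaves one modulo `2π`, the period of `s ↦ exp (s ξ)`. Here
  -- `σA` is `-A` or `A`, which decides between a shift by `p` and one by `-p`.
  have hk : (σ : ℤ) * A = 2 * Real.pi * q + 2 * Real.pi * (-n : ℤ) := by
    push_cast
    linarith
  have hexp : NormedSpace.exp (((σ : ℤ) * A) • ξ) = NormedSpace.exp ((2 * Real.pi * q) • ξ) := by
    rw [hk, HopfLift.exp_add_smul, HopfLift.exp_two_pi_int_smul hξ, mul_one]
  have hneg : σ = -1 → ∀ x, γhat (x + p) = γhat x * NormedSpace.exp ((2 * Real.pi * q) • ξ) := by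
    rintro rfl x
    rw [← hexp, ← hhol x, mul_assoc, ← HopfLift.exp_add_smul]
    simp
  have hpos : σ = 1 → ∀ x, γhat (x - p) = γhat x * NormedSpace.exp ((2 * Real.pi * q) • ξ) := by
    rintro rfl x
    rw [← hexp, ← hhol (x - p), sub_add_cancel]
    simp
  refine ⟨?_, hneg, hpos⟩
  rcases Int.units_eq_one_or σ with h | h
  · exact ⟨-p, fun x => by rw [← sub_eq_add_neg, hpos h]⟩
  · exact ⟨p, hneg h⟩
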